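/- Let $m\in\{2,6,10,14,\dots\}$ and $p,q\in[0,1/2)$ be fixed. For $n\ge 1$ let $\mathcal G=(\mathcal V,\mathcal E)$ be the complete $m$-uniform hypergraph on $\mathcal V=[n]$, that is, $\mathcal E$ consists of all $m$-element subsets of $[n]$, and let $y^\ast\in\{-1,+1\}^n$ be an arbitrary (unknown) label vector. One observes a symmetric tensor $X\in\{-1,0,1\}^{n^{\otimes m}}$ and a vector $z\in\{-1,1\}^n$, where, independently over all hyperedges and all vertices: for each hyperedge $\{i_1,\dots,i_m\}\in\mathcal E$ the entry $X_{i_1,\dots,i_m}$ (together with all its permutations) equals $y^\ast_{i_1}\cdots y^\ast_{i_m}$ with probability $1-p$ and $-y^\ast_{i_1}\cdots y^\ast_{i_m}$ with probability $p$; the entries of $X$ at tuples that do not form a hyperedge are $0$; and $z_i$ equals $y^\ast_i$ with probability $1-q$ and $-y^\ast_i$ with probability $q$. The two-stage approach is the following. Stage one solves the convex program: maximize $\langle X,Y\rangle=\sum_{i_1,\dots,i_m}X_{i_1,\dots,i_m}Y_{i_1,\dots,i_m}$ over all $Y\in\mathbb R^{n^{\otimes m}}$ such that $Y=\sum_{j=1}^{\binom{m+n-1}{m}}(v^{(j)})^{\otimes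 m}$ for some $v^{(j)}\in\mathbb R^n$; $Y_{i_1,\dots,i_m}=1$ for every tuple in which each index occurs an even number of times; and $-1\le Y_{i_1,\dots,i_m}\le 1$ for every other tuple in which some index is repeated. The solution is factored as $Y=y^{\otimes m}=(-y)^{\otimes m}$ with $y\in\{-1,1\}^n$. Stage two outputs a maximizer of $z^\top y'$ over $y'\in\{y,-y\}$. Exact inference is achieved if $(y^\ast)^{\otimes m}$ is the unique solution of the program of stage one and $y^\ast$ is the unique possible output of stage two. Then there are constants $C>0$ and $n_0$, depending only on $m,p,q$, such that for all $n\ge n_0$ and all $y^\ast\in\{-1,1\}^n$, exact inference is achieved with probability at least $1-C/n$. In particular, for every choice of label vectors $y^\ast=y^{\ast,(n)}\in\{-1,1\}^n$, the probability of exact inference tends to $1$ as $n\to\infty$. -/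

import Mathlib

open MeasureTheory Filter Topology

/-- Real tensors of order `m` and dimension `n`. -/
abbrev RealTensor (n m : ℕ) : Type := (Fin m → Fin n) → ℝ

/-- The rank-one tensor `v ⊗ ⋯ ⊗ v` (`m` factors). -/
def tensorPower {n : ℕ} (m : ℕ) (v : Fin n → ℝ) : RealTensor n m :=
  fun i => ∏ k, v (i k)

/-- The entrywise inner product of two tensors of the same shape. -/
def tensorInner {n m : ℕ} (A B : RealTensor n m) : ℝ := ∑ i, A i * B i

/-- The Caratheodory tensor cone: sums of at most `(m + n - 1).choose m` rank-one tensors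
(summands may be zero). -/
def caratheodoryCone (n m : ℕ) : Set (RealTensor n m) :=
  {Y | ∃ v : Fin ((m + n - 1).choose m) → Fin n → ℝ, Y = ∑ j, tensorPower m (v j)}

/-- The index tuples in which every index occurs an even number of times. -/
def evenTuples (n m : ℕ) : Set (Fin m → Fin n) :=
  {i | ∀ a : Fin n, Even (Finset.univ.filter (fun k => i k = a)).card}

/-- The index tuples that are not in `evenTuples` and in which at least one index is repeated. -/
def oddTuples (n m : ℕ) : Set (Fin m → Fin n) :=
  {i | i ∉ evenTuples n m ∧ ¬ Function.Injective i}

/-- The feasible set of the convex program of stage one. -/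
def stageOneFeasible (n m : ℕ) : Set (RealTensor n m) :=
  {Y | Y ∈ caratheodoryCone n m ∧
    (∀ i ∈ oddTuples n m, -1 ≤ Y i ∧ Y i ≤ 1) ∧
    (∀ i ∈ evenTuples n m, Y i = 1)}

/-- `Y` solves stage one: it maximizes `⟨X, Y⟩` over the feasible set. -/
def IsStageOneSolution {n m : ℕ} (X Y : RealTensor n m) : Prop :=
  Y ∈ stageOneFeasible n m ∧ ∀ Y' ∈ stageOneFeasible n m, tensorInner X Y' ≤ tensorInner X Y

/-- Vectors with entries in `{+1, -1}`. -/
def IsSignVector {n : ℕ} (y : Fin n → ℝ) : Prop := ∀ i, y i = 1 ∨ y i = -1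

/-- `y` is a possible output of the two-stage approach on the observations `X`, `z`: stage one
returns a solution `Y`, which is factored as `Y = y ⊗ ⋯ ⊗ y = (-y) ⊗ ⋯ ⊗ (-y)` with a sign
vector `y`, and stage two picks a maximizer of `zᵀ y'` over `y' ∈ {y, -y}`. -/
def IsTwoStageOutput {n m : ℕ} (X : RealTensor n m) (z y : Fin n → ℝ) : Prop :=
  ∃ Y, IsStageOneSolution X Y ∧ IsSignVector y ∧ Y = tensorPower m y ∧
    ∀ y' ∈ ({y, -y} : Set (Fin n → ℝ)), ∑ i, z i * y' i ≤ ∑ i, z i * y i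

/-- Exact inference of the labels `yStar`: the program of stage one has `yStar ⊗ ⋯ ⊗ yStar` as its
unique solution, and the two-stage approach outputs `yStar` and nothing else. -/
def ExactInference {n m : ℕ} (X : RealTensor n m) (z yStar : Fin n → ℝ) : Prop :=
  (∀ Y, IsStageOneSolution X Y ↔ Y = tensorPower m yStar) ∧
    ∀ y, IsTwoStageOutput X z y ↔ y = yStar

/-- An `m`-uniform hypergraph with vertex set `Fin n`. -/
structure UniformHypergraph (n m : ℕ) where
  edges : Finset (Finset (Fin n))
  card_eq : ∀ e ∈ edges, e.card = m

/-- A uniform hypergraph is complete if all sets of `m` vertices are hyperedges. -/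
def UniformHypergraph.IsComplete {n m : ℕ} (G : UniformHypergraph n m) : Prop :=
  ∀ e : Finset (Fin n), e.card = m → e ∈ G.edges

/-- The law of a noise bit: `true` (the observation is flipped) with probability `r`,
`false` with probability `1 - r`. -/
noncomputable def flipLaw (r : ℝ) : Measure Bool :=
  ENNReal.ofReal (1 - r) • Measure.dirac false + ENNReal.ofReal r • Measure.dirac true

theorem isProbabilityMeasure_flipLaw {r : ℝ} (h0 : 0 ≤ r) (h1 : r ≤ 1) :
    IsProbabilityMeasure (flipLaw r) := by
  constructor
  simp [flipLaw, ← ENNReal.ofReal_add (sub_nonneg.2 h1) h0]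

/-- The sign by which a noise bit multiplies an observation. -/
def flipSign (b : Bool) : ℝ := if b then -1 else 1

/-- The sample space: one noise bit for each hyperedge and one for each vertex. -/
abbrev UniformHypergraph.Noise {n m : ℕ} (G : UniformHypergraph n m) : Type :=
  (G.edges → Bool) × (Fin n → Bool)

/-- The law of the noise: all bits are independent, those of the hyperedges flip with
probability `p`, those of the vertices with probability `q`. -/
noncomputable def UniformHypergraph.noiseLaw {n m : ℕ} (G : UniformHypergraph n m) (p q : ℝ) :
    Measure G.Noise :=
  (Measure.pi fun _ : G.edges => flipLaw p).prod (Measure.pi fun _ : Fin n => flipLaw q)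

/-- The hyperedge observation tensor. If `{i₁, …, iₘ}` is a hyperedge (in particular the indices
are distinct), then the entry at `(i₁, …, iₘ)`, and likewise at all permutations of it, is the
product of the labels of the vertices, flipped by the noise bit of the hyperedge; all other
entries are zero. -/
noncomputable def UniformHypergraph.hyperedgeObservation {n m : ℕ} (G : UniformHypergraph n m)
    (yStar : Fin n → ℝ) (ω : G.Noise) : RealTensor n m :=
  fun i => if h : Finset.univ.image i ∈ G.edges then
    flipSign (ω.1 ⟨Finset.univ.image i, h⟩) * ∏ k, yStar (i k) else 0

/-- The node observation vector. -/
def UniformHypergraph.nodeObservation {n m : ℕ} (G : UniformHypergraph n m)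
    (yStar : Fin n → ℝ) (ω : G.Noise) : Fin n → ℝ :=
  fun i => flipSign (ω.2 i) * yStar i

/-- The probability that the two-stage approach achieves exact inference of `yStar`. -/
noncomputable def UniformHypergraph.successProb {n m : ℕ} (G : UniformHypergraph n m)
    (p q : ℝ) (yStar : Fin n → ℝ) : ℝ :=
  (G.noiseLaw p q).real
    {ω | ExactInference (G.hyperedgeObservation yStar ω) (G.nodeObservation yStar ω) yStar}

lemma flipSign_eq_or (b : Bool) : flipSign b = 1 ∨ flipSign b = -1 := by
  cases b <;> simp [flipSign]

lemma integral_flipLaw {r : ℝ} (h0 : 0 ≤ r) (h1 : r ≤ 1) (f : Bool → ℝ) :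
    ∫ b, f b ∂(flipLaw r) = (1 - r) * f false + r * f true := by
  unfold flipLaw
  rw [integral_add_measure (Integrable.of_finite.smul_measure ENNReal.ofReal_ne_top)
      (Integrable.of_finite.smul_measure ENNReal.ofReal_ne_top),
    integral_smul_measure, integral_smul_measure]
  simp [ENNReal.toReal_ofReal h0, ENNReal.toReal_ofReal (sub_nonneg.2 h1)]

/-- Products of centered independent noise signs over a nonempty index set have mean zero. -/
lemma integral_prod_centered_flipSign {ι : Type*} [Fintype ι] {r : ℝ} (h0 : 0 ≤ r) (h1 : r ≤ 1)
    {T : Finset ι} (hT : T.Nonempty) :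
    ∫ ω, ∏ e ∈ T, (flipSign (ω e) - (1 - 2 * r)) ∂(Measure.pi fun _ : ι => flipLaw r) = 0 := by
  classical
  have := isProbabilityMeasure_flipLaw h0 h1
  have key : ∀ ω : ι → Bool, ∏ e ∈ T, (flipSign (ω e) - (1 - 2 * r)) =
      ∏ e, (fun (e : ι) (b : Bool) => if e ∈ T then flipSign b - (1 - 2 * r) else 1) e (ω e) := by
    intro ω
    simp [Finset.prod_ite_mem]
  rw [integral_congr_ae (ae_of_all _ key)]
  refine (integral_fintype_prod_eq_prod
    (fun (e : ι) (b : Bool) => if e ∈ T then flipSign b - (1 - 2 * r) else 1)).trans ?_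
  obtain ⟨e, he⟩ := hT
  refine Finset.prod_eq_zero (Finset.mem_univ e) ?_
  simp only [he, if_true]
  rw [integral_flipLaw h0 h1]
  simp [flipSign]
  ring

/-- Hoeffding's inequality for sums of independent noise signs. -/
lemma measureReal_sum_flipSign_le {ι : Type*} [Fintype ι] {r : ℝ} (h0 : 0 ≤ r) (h1 : r < 1 / 2)
    (S : Finset ι) :
    (Measure.pi fun _ : ι => flipLaw r).real
      {ω | ∑ e ∈ S, flipSign (ω e) ≤ (1 - 2 * r) / 2 * S.card} ≤
      Real.exp (-((1 - 2 * r) ^ 2 / 8) * S.card) := by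
  have := isProbabilityMeasure_flipLaw h0 (by linarith : r ≤ 1)
  set X : ι → (ι → Bool) → ℝ := fun e ω => (1 - 2 * r) - flipSign (ω e) with hX
  have hind : ProbabilityTheory.iIndepFun X (Measure.pi fun _ : ι => flipLaw r) :=
    ProbabilityTheory.iIndepFun_pi (μ := fun _ : ι => flipLaw r)
      (X := fun _ b => (1 - 2 * r) - flipSign b) (fun _ => (measurable_of_finite _).aemeasurable)
  have hmean : ∀ e, ∫ ω, X e ω ∂(Measure.pi fun _ : ι => flipLaw r) = 0 := by
    intro e
    have := integral_prod_centered_flipSign (ι := ι) h0 (by linarith : r ≤ 1)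
      (Finset.singleton_nonempty e)
    simp only [Finset.prod_singleton] at this
    rw [← neg_eq_zero, ← integral_neg, ← this]
    simp [hX]
  have hsub : ∀ e ∈ S, ProbabilityTheory.HasSubgaussianMGF (X e)
      ((‖(2 - 2 * r) - (- 2 * r)‖₊ / 2) ^ 2) (Measure.pi fun _ : ι => flipLaw r) := by
    intro e _
    refine ProbabilityTheory.hasSubgaussianMGF_of_mem_Icc_of_integral_eq_zero
      (measurable_of_finite _).aemeasurable (ae_of_all _ fun ω => ?_) (hmean e)
    rcases flipSign_eq_or (ω e) with h | h <;> simp only [hX, h, Set.mem_Icc] <;>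
      constructor <;> linarith
  have key := ProbabilityTheory.HasSubgaussianMGF.measure_sum_ge_le_of_iIndepFun hind hsub
    (ε := (1 - 2 * r) / 2 * S.card) (by have : 0 < 1 - 2 * r := by linarith
                                        positivity)
  have hset : {ω : ι → Bool | ∑ e ∈ S, flipSign (ω e) ≤ (1 - 2 * r) / 2 * S.card} =
      {ω | (1 - 2 * r) / 2 * S.card ≤ ∑ e ∈ S, X e ω} := by
    ext ω
    simp only [hX, Set.mem_ofPred_eq, Finset.sum_sub_distrib, Finset.sum_const, nsmul_eq_mul]
    constructor <;> intro h <;> linarith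
  rw [hset]
  refine key.trans (Real.exp_le_exp.2 (le_of_eq ?_))
  have hc : ((‖(2 - 2 * r) - (- 2 * r)‖₊ / 2) ^ 2 : NNReal) = 1 := by
    have : (2 - 2 * r) - (- 2 * r) = 2 := by ring
    rw [this]
    simp
  rw [hc]
  rcases S.eq_empty_or_nonempty with rfl | hS
  · simp
  · have : (0 : ℝ) < S.card := by exact_mod_cast hS.card_pos
    simp
    field_simp
    ring

lemma exp_neg_mul_natCast_le {c : ℝ} (hc : 0 < c) {n : ℕ} (hn : 0 < n) :
    Real.exp (-c * n) ≤ 1 / c / n := by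
  have hn' : (0 : ℝ) < n := by exact_mod_cast hn
  rw [neg_mul, Real.exp_neg, div_div, one_div]
  apply inv_anti₀ (by positivity)
  linarith [Real.add_one_le_exp (c * n)]

lemma natCast_mul_exp_neg_mul_natCast_le {c : ℝ} (hc : 0 < c) {n : ℕ} (hn : 0 < n) :
    n * Real.exp (-c * n) ≤ 2 / c ^ 2 / n := by
  have hn' : (0 : ℝ) < n := by exact_mod_cast hn
  have := Real.quadratic_le_exp_of_nonneg (x := c * n) (by positivity)
  have h2 : (c * n) ^ 2 / 2 ≤ Real.exp (c * n) := by nlinarith [mul_pos hc hn']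
  rw [neg_mul, Real.exp_neg]
  calc n * (Real.exp (c * n))⁻¹ ≤ n * ((c * n) ^ 2 / 2)⁻¹ := by gcongr
    _ = _ := by field_simp

lemma tensorPower_zero {n m : ℕ} (hm : 0 < m) : tensorPower m (0 : Fin n → ℝ) = 0 := by
  funext i
  exact Finset.prod_eq_zero (Finset.mem_univ ⟨0, hm⟩) rfl

lemma tensorPower_smul {n m : ℕ} (c : ℝ) (v : Fin n → ℝ) :
    tensorPower m (c • v) = c ^ m • tensorPower m v := by
  funext i
  simp [tensorPower, Finset.prod_mul_distrib]

lemma tensorInner_sum_right {n m : ℕ} {ι : Type*} (s : Finset ι) (X : RealTensor n m)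
    (Y : ι → RealTensor n m) :
    tensorInner X (∑ j ∈ s, Y j) = ∑ j ∈ s, tensorInner X (Y j) := by
  simp only [tensorInner, Finset.sum_apply, Finset.mul_sum]
  rw [Finset.sum_comm]

lemma tensorInner_smul_right {n m : ℕ} (X : RealTensor n m) (c : ℝ) (Y : RealTensor n m) :
    tensorInner X (c • Y) = c * tensorInner X Y := by
  simp only [tensorInner, Pi.smul_apply, smul_eq_mul, Finset.mul_sum]
  exact Finset.sum_congr rfl fun i _ => by ring

lemma IsSignVector.sq_eq_one {n : ℕ} {y : Fin n → ℝ} (hy : IsSignVector y) (a : Fin n) :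
    y a ^ 2 = 1 := by
  rcases hy a with h | h <;> simp [h]

lemma IsSignVector.mul_self {n : ℕ} {y : Fin n → ℝ} (hy : IsSignVector y) (a : Fin n) :
    y a * y a = 1 := by
  rw [← sq, hy.sq_eq_one]

lemma IsSignVector.mul {n : ℕ} {y s : Fin n → ℝ} (hy : IsSignVector y) (hs : IsSignVector s) :
    IsSignVector (y * s) := by
  intro a
  rcases hy a with h | h <;> rcases hs a with h' | h' <;> simp [h, h']

lemma IsSignVector.prod_eq_or {n : ℕ} {y : Fin n → ℝ} (hy : IsSignVector y) {ι : Type*}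
    (s : Finset ι) (i : ι → Fin n) : ∏ k ∈ s, y (i k) = 1 ∨ ∏ k ∈ s, y (i k) = -1 := by
  rw [← sq_eq_one_iff, ← Finset.prod_pow]
  exact Finset.prod_eq_one fun k _ => hy.sq_eq_one _

lemma tensorPower_mem_stageOneFeasible {n m : ℕ} (hn : 0 < n) (hm : 0 < m) {y : Fin n → ℝ}
    (hy : IsSignVector y) : tensorPower m y ∈ stageOneFeasible n m := by
  classical
  refine ⟨?_, ?_, ?_⟩
  · have hpos : 0 < (m + n - 1).choose m := Nat.choose_pos (by omega)
    refine ⟨Pi.single ⟨0, hpos⟩ y, ?_⟩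
    rw [Finset.sum_eq_single ⟨0, hpos⟩]
    · simp
    · intro j _ hj
      rw [Pi.single_eq_of_ne hj, tensorPower_zero hm]
    · simp
  · intro i _
    rcases hy.prod_eq_or Finset.univ i with h | h <;> simp [tensorPower, h]
  · intro i hi
    rw [tensorPower, Finset.prod_comp]
    refine Finset.prod_eq_one fun a _ => ?_
    obtain ⟨r, hr⟩ := (hi a).two_dvd
    rw [hr, pow_mul, hy.sq_eq_one, one_pow]

lemma isStageOneSolution_iff_of_forall_lt {n m : ℕ} {X Z : RealTensor n m}
    (hZ : Z ∈ stageOneFeasible n m)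
    (h : ∀ Y ∈ stageOneFeasible n m, tensorInner X Z ≤ tensorInner X Y → Y = Z) :
    ∀ Y, IsStageOneSolution X Y ↔ Y = Z := by
  intro Y
  constructor
  · exact fun hY => h Y hY.1 (hY.2 Z hZ)
  · rintro rfl
    refine ⟨hZ, fun Y' hY' => ?_⟩
    by_contra! hlt
    rw [h Y' hY' hlt.le] at hlt
    exact lt_irrefl _ hlt

/-- The index tuple whose first `r` entries are `a` and whose remaining entries are `b`. -/
def blockTuple {n : ℕ} (m r : ℕ) (a b : Fin n) : Fin m → Fin n :=
  fun k => if k.val < r then a else b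

lemma card_filter_val_not_lt {m r : ℕ} (hr : r ≤ m) :
    (Finset.univ.filter fun k : Fin m => ¬ k.val < r).card = m - r := by
  have h := Finset.card_filter_add_card_filter_not (s := (Finset.univ : Finset (Fin m)))
    (fun k : Fin m => k.val < r)
  rw [Fin.card_filter_val_lt, Finset.card_univ, Fintype.card_fin] at h
  omega

lemma tensorPower_blockTuple {n m r : ℕ} (hr : r ≤ m) (v : Fin n → ℝ) (a b : Fin n) :
    tensorPower m v (blockTuple m r a b) = v a ^ r * v b ^ (m - r) := by
  have : ∀ k : Fin m, v (blockTuple m r a b k) = if k.val < r then v a else v b := by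
    intro k
    unfold blockTuple
    split_ifs <;> rfl
  simp_rw [tensorPower, this]
  rw [Finset.prod_ite, Finset.prod_const, Finset.prod_const, card_filter_val_not_lt hr,
    Fin.card_filter_val_lt, min_eq_right hr]

lemma blockTuple_mem_evenTuples {n m r : ℕ} (hr : r ≤ m) (hre : Even r) (hme : Even m)
    (a b : Fin n) : blockTuple m r a b ∈ evenTuples n m := by
  intro x
  have : ∀ k : Fin m, (if blockTuple m r a b k = x then 1 else 0) =
      if k.val < r then (if a = x then 1 else 0) else (if b = x then 1 else 0) := by
    intro k
    unfold blockTuple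
    split_ifs <;> rfl
  rw [Finset.card_filter]
  simp_rw [this]
  rw [Finset.sum_ite, Finset.sum_const, Finset.sum_const, card_filter_val_not_lt hr,
    Fin.card_filter_val_lt, min_eq_right hr]
  exact (hre.mul_right _).add ((hme.tsub hre).mul_right _)

lemma sum_pow_mul_pow_eq_one {n m r : ℕ} (hr : r ≤ m) (hre : Even r) (hme : Even m) {N : ℕ}
    {v : Fin N → Fin n → ℝ} (hY : ∀ i ∈ evenTuples n m, (∑ j, tensorPower m (v j)) i = 1)
    (a b : Fin n) : ∑ j, v j a ^ r * v j b ^ (m - r) = 1 := by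
  rw [← hY _ (blockTuple_mem_evenTuples hr hre hme a b), Finset.sum_apply]
  exact Finset.sum_congr rfl fun j _ => (tensorPower_blockTuple hr _ a b).symm

lemma sub_mul_pow_sub_pow_nonneg {x y : ℝ} (hx : 0 ≤ x) (hy : 0 ≤ y) (k : ℕ) :
    0 ≤ (x - y) * (x ^ k - y ^ k) := by
  rcases le_total x y with h | h
  · exact mul_nonneg_of_nonpos_of_nonpos (by linarith) (by linarith [pow_le_pow_left₀ hx h k])
  · exact mul_nonneg (by linarith) (by linarith [pow_le_pow_left₀ hy h k])

lemma eq_of_sub_mul_pow_sub_pow_eq_zero {x y : ℝ} (hx : 0 ≤ x) (hy : 0 ≤ y) {k : ℕ} (hk : k ≠ 0)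
    (h : (x - y) * (x ^ k - y ^ k) = 0) : x = y := by
  rcases mul_eq_zero.1 h with h | h
  · linarith
  · exact (pow_left_inj₀ hx hy hk).1 (by linarith)

/-- If the order is at least four, the normalization of the even entries forces each rank-one
summand to be a multiple of the tensor power of a sign vector. -/
lemma abs_eq_abs_of_even_entries {n m : ℕ} (hm4 : 4 ≤ m) (hme : Even m) {N : ℕ}
    {v : Fin N → Fin n → ℝ} (hY : ∀ i ∈ evenTuples n m, (∑ j, tensorPower m (v j)) i = 1)
    (j : Fin N) (a b : Fin n) : |v j a| = |v j b| := by
  obtain ⟨k, hk⟩ : ∃ k, m = 2 * k + 2 := by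
    obtain ⟨l, hl⟩ := hme.two_dvd
    exact ⟨l - 1, by omega⟩
  have h1 := sum_pow_mul_pow_eq_one le_rfl hme hme hY a a
  have h2 := sum_pow_mul_pow_eq_one le_rfl hme hme hY b b
  have h3 := sum_pow_mul_pow_eq_one (r := 2) (by omega) even_two hme hY a b
  have h4 := sum_pow_mul_pow_eq_one (r := 2) (by omega) even_two hme hY b a
  have hsum : ∑ j, ((v j a ^ 2 - v j b ^ 2) * ((v j a ^ 2) ^ k - (v j b ^ 2) ^ k)) = 0 := by
    have : ∀ j, (v j a ^ 2 - v j b ^ 2) * ((v j a ^ 2) ^ k - (v j b ^ 2) ^ k) =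
        v j a ^ m * v j a ^ (m - m) + v j b ^ m * v j b ^ (m - m)
          - v j a ^ 2 * v j b ^ (m - 2) - v j b ^ 2 * v j a ^ (m - 2) := by
      intro j
      have : m - 2 = 2 * k := by omega
      rw [Nat.sub_self, this, hk, pow_add, pow_add, pow_mul, pow_mul]
      ring
    simp_rw [this]
    rw [Finset.sum_sub_distrib, Finset.sum_sub_distrib, Finset.sum_add_distrib, h1, h2, h3, h4]
    norm_num
  have h0 := (Finset.sum_eq_zero_iff_of_nonneg fun j _ =>
    sub_mul_pow_sub_pow_nonneg (sq_nonneg (v j a)) (sq_nonneg (v j b)) k).1 hsum j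
      (Finset.mem_univ j)
  exact sq_eq_sq_iff_abs_eq_abs _ _ |>.1
    (eq_of_sub_mul_pow_sub_pow_eq_zero (sq_nonneg _) (sq_nonneg _) (by omega) h0)

lemma exists_isSignVector_smul {n : ℕ} (v : Fin n → ℝ) (a₀ : Fin n)
    (h : ∀ a b, |v a| = |v b|) : ∃ s : Fin n → ℝ, IsSignVector s ∧ v = |v a₀| • s := by
  refine ⟨fun a => if 0 ≤ v a then 1 else -1, fun a => ?_, funext fun a => ?_⟩
  · dsimp only
    split_ifs <;> simp
  · rw [h a₀ a]
    by_cases ha : 0 ≤ v a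
    · simp [ha, abs_of_nonneg ha]
    · simp [ha, abs_of_neg (not_le.1 ha)]

/-- For orders at least four, the program of stage one is decided by the values of its objective
at the tensor powers of sign vectors. -/
lemma isStageOneSolution_iff_of_sign_vectors {n m : ℕ} (hn : 0 < n) (hm4 : 4 ≤ m) (hme : Even m)
    {X : RealTensor n m} {y : Fin n → ℝ} (hy : IsSignVector y)
    (hX : ∀ s, IsSignVector s → tensorPower m s ≠ tensorPower m y →
      tensorInner X (tensorPower m s) < tensorInner X (tensorPower m y)) :
    ∀ Y, IsStageOneSolution X Y ↔ Y = tensorPower m y := by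
  refine isStageOneSolution_iff_of_forall_lt
    (tensorPower_mem_stageOneFeasible hn (by omega) hy) ?_
  rintro _ ⟨⟨v, rfl⟩, -, hev⟩ hle
  choose s hs hvs using fun j =>
    exists_isSignVector_smul (v j) ⟨0, hn⟩ (abs_eq_abs_of_even_entries hm4 hme hev j)
  set c : Fin ((m + n - 1).choose m) → ℝ := fun j => |v j ⟨0, hn⟩| ^ m with hc
  have hvc : ∀ j, tensorPower m (v j) = c j • tensorPower m (s j) := by
    intro j
    conv_lhs => rw [hvs j]
    rw [tensorPower_smul]
  have hc0 : ∀ j, 0 ≤ c j := fun j => by positivity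
  have hc1 : ∑ j, c j = 1 := by
    rw [← sum_pow_mul_pow_eq_one le_rfl hme hme hev ⟨0, hn⟩ ⟨0, hn⟩]
    refine Finset.sum_congr rfl fun j _ => ?_
    simp [hc, hme.pow_abs]
  have hle' : ∀ j, tensorInner X (tensorPower m (s j)) ≤ tensorInner X (tensorPower m y) := by
    intro j
    by_cases h : tensorPower m (s j) = tensorPower m y
    · rw [h]
    · exact (hX _ (hs j) h).le
  have hsum : ∑ j, c j * (tensorInner X (tensorPower m y) -
      tensorInner X (tensorPower m (s j))) = 0 := by
    refine le_antisymm ?_ (Finset.sum_nonneg fun j _ =>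
      mul_nonneg (hc0 j) (sub_nonneg.2 (hle' j)))
    simp_rw [mul_sub]
    rw [Finset.sum_sub_distrib, ← Finset.sum_mul, hc1, one_mul, sub_nonpos]
    refine hle.trans (le_of_eq ?_)
    rw [tensorInner_sum_right]
    exact Finset.sum_congr rfl fun j _ => by rw [hvc, tensorInner_smul_right]
  have hz := (Finset.sum_eq_zero_iff_of_nonneg fun j _ =>
    mul_nonneg (hc0 j) (sub_nonneg.2 (hle' j))).1 hsum
  calc ∑ j, tensorPower m (v j) = ∑ j, c j • tensorPower m y := by
        refine Finset.sum_congr rfl fun j hj => ?_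
        rw [hvc]
        rcases mul_eq_zero.1 (hz j hj) with h | h
        · rw [h, zero_smul, zero_smul]
        · by_cases h' : tensorPower m (s j) = tensorPower m y
          · rw [h']
          · linarith [hX _ (hs j) h']
    _ = tensorPower m y := by rw [← Finset.sum_smul, hc1, one_smul]

lemma eq_or_eq_neg_of_tensorPower_eq {n m : ℕ} (hn : 0 < n) (hm : 0 < m) (hme : Even m)
    {y s : Fin n → ℝ} (hy : IsSignVector y) (hs : IsSignVector s)
    (h : tensorPower m s = tensorPower m y) : s = y ∨ s = -y := by
  have key : ∀ a, s a * s ⟨0, hn⟩ = y a * y ⟨0, hn⟩ := by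
    intro a
    have := congrFun h (blockTuple m 1 a ⟨0, hn⟩)
    rw [tensorPower_blockTuple hm, tensorPower_blockTuple hm] at this
    obtain ⟨k, hk⟩ : ∃ k, m - 1 = 2 * k + 1 := by
      obtain ⟨l, hl⟩ := hme.two_dvd
      exact ⟨l - 1, by omega⟩
    rw [hk] at this
    simpa [pow_add, pow_mul, hs.sq_eq_one, hy.sq_eq_one] using this
  rcases hy ⟨0, hn⟩ with h1 | h1 <;> rcases hs ⟨0, hn⟩ with h2 | h2 <;> rw [h1, h2] at key
  · left; funext a; linarith [key a]
  · right; funext a; simp only [Pi.neg_apply]; linarith [key a]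
  · right; funext a; simp only [Pi.neg_apply]; linarith [key a]
  · left; funext a; linarith [key a]

lemma tensorPower_neg {n m : ℕ} (hme : Even m) (y : Fin n → ℝ) :
    tensorPower m (-y) = tensorPower m y := by
  rw [← neg_one_smul ℝ y, tensorPower_smul, hme.neg_one_pow, one_smul]

lemma exactInference_of_isStageOneSolution_iff {n m : ℕ} (hn : 0 < n) (hm : 0 < m)
    (hme : Even m) {X : RealTensor n m} {z y : Fin n → ℝ} (hy : IsSignVector y)
    (h : ∀ Y, IsStageOneSolution X Y ↔ Y = tensorPower m y) (hz : 0 < ∑ i, z i * y i) :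
    ExactInference X z y := by
  refine ⟨h, fun s => ⟨?_, ?_⟩⟩
  · rintro ⟨Y, hY, hs, rfl, hmax⟩
    rcases eq_or_eq_neg_of_tensorPower_eq hn hm hme hy hs ((h _).1 hY) with rfl | rfl
    · rfl
    · have := hmax y (by simp)
      simp only [Pi.neg_apply, mul_neg, Finset.sum_neg_distrib] at this
      linarith
  · rintro rfl
    refine ⟨_, (h _).2 rfl, hy, rfl, ?_⟩
    rintro y' (rfl | rfl)
    · exact le_rfl
    · simp only [Pi.neg_apply, mul_neg, Finset.sum_neg_distrib]
      linarith

/-- The noise sign of an edge, extended by zero to all vertex sets that are not edges. -/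
noncomputable def UniformHypergraph.edgeSign {n m : ℕ} (G : UniformHypergraph n m)
    (ω : G.edges → Bool) (e : Finset (Fin n)) : ℝ :=
  if h : e ∈ G.edges then flipSign (ω ⟨e, h⟩) else 0

/-- The tensor whose entry at a tuple is the sign of its underlying set times the product of
the labels. -/
def labelTensor {n : ℕ} (m : ℕ) (σ : Finset (Fin n) → ℝ) (y : Fin n → ℝ) : RealTensor n m :=
  fun i => σ (Finset.univ.image i) * ∏ k, y (i k)

namespace UniformHypergraph

variable {n m : ℕ} (G : UniformHypergraph n m)

lemma hyperedgeObservation_eq (y : Fin n → ℝ) (ω : G.Noise) :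
    G.hyperedgeObservation y ω = labelTensor m (G.edgeSign ω.1) y := by
  funext i
  unfold hyperedgeObservation labelTensor edgeSign
  split_ifs <;> simp

lemma edgeSign_of_notMem (ω : G.edges → Bool) {e : Finset (Fin n)} (he : e ∉ G.edges) :
    G.edgeSign ω e = 0 := dif_neg he

lemma edgeSign_eq_or (ω : G.edges → Bool) {e : Finset (Fin n)} (he : e ∈ G.edges) :
    G.edgeSign ω e = 1 ∨ G.edgeSign ω e = -1 := by
  rw [edgeSign, dif_pos he]
  exact flipSign_eq_or _

lemma measureReal_sum_edgeSign_le {p : ℝ} (h0 : 0 ≤ p) (h1 : p < 1 / 2)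
    {T : Finset (Finset (Fin n))} (hT : T ⊆ G.edges) :
    (Measure.pi fun _ : G.edges => flipLaw p).real
      {ω | ∑ e ∈ T, G.edgeSign ω e ≤ (1 - 2 * p) / 2 * T.card} ≤
      Real.exp (-((1 - 2 * p) ^ 2 / 8) * T.card) := by
  have hcard : (T.subtype (· ∈ G.edges)).card = T.card := by
    rw [Finset.card_subtype, Finset.filter_true_of_mem fun e he => hT he]
  have := measureReal_sum_flipSign_le h0 h1 (T.subtype (· ∈ G.edges))
  rw [hcard] at this
  have hsum : ∀ ω, ∑ e ∈ T, G.edgeSign ω e =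
      ∑ e ∈ T.subtype (· ∈ G.edges), flipSign (ω e) := by
    intro ω
    rw [← Finset.sum_subtype_of_mem _ fun e he => hT he]
    exact Finset.sum_congr rfl fun e _ => by rw [edgeSign, dif_pos e.2]
  simp_rw [hsum]
  exact this

lemma integral_prod_centered_edgeSign {p : ℝ} (h0 : 0 ≤ p) (h1 : p ≤ 1)
    {T : Finset (Finset (Fin n))} (hT : T ⊆ G.edges) (hne : T.Nonempty) :
    ∫ ω, ∏ e ∈ T, (G.edgeSign ω e - (1 - 2 * p)) ∂(Measure.pi fun _ : G.edges => flipLaw p) =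
      0 := by
  obtain ⟨e₀, he₀⟩ := hne
  rw [← integral_prod_centered_flipSign h0 h1
    (T := T.subtype (· ∈ G.edges)) ⟨⟨e₀, hT he₀⟩, by simpa using he₀⟩]
  congr 1
  funext ω
  rw [← Finset.prod_subtype_of_mem _ fun e he => hT he]
  exact Finset.prod_congr rfl fun e _ => by rw [edgeSign, dif_pos e.2]

end UniformHypergraph

lemma card_filter_image_eq {n m : ℕ} {e : Finset (Fin n)} (he : e.card = m) :
    (Finset.univ.filter fun i : Fin m → Fin n => Finset.univ.image i = e).card =
      m.factorial := by
  classical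
  have hE : Fintype.card (Fin m) = Fintype.card e := by simp [he]
  have hcard := Fintype.card_equiv (Fintype.equivOfCardEq hE)
  rw [Fintype.card_fin] at hcard
  rw [← hcard, ← Finset.card_univ]
  symm
  refine Finset.card_bij (fun f _ k => (f k : Fin n)) ?_ ?_ ?_
  · intro f _
    simp only [Finset.mem_filter, Finset.mem_univ, true_and]
    ext a
    simp only [Finset.mem_image, Finset.mem_univ, true_and]
    constructor
    · rintro ⟨k, rfl⟩
      exact (f k).2
    · intro ha
      exact ⟨f.symm ⟨a, ha⟩, by simp⟩
  · intro f _ g _ hfg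
    ext k
    exact congrArg Fin.val (congrFun hfg k)
  · intro i hi
    simp only [Finset.mem_filter, Finset.mem_univ, true_and] at hi
    have hmem : ∀ k, i k ∈ e := fun k => hi ▸ Finset.mem_image_of_mem i (Finset.mem_univ k)
    have hs : Function.Surjective fun k => (⟨i k, hmem k⟩ : e) := by
      rintro ⟨a, ha⟩
      rw [← hi] at ha
      obtain ⟨k, -, hk⟩ := Finset.mem_image.1 ha
      exact ⟨k, Subtype.ext hk⟩
    exact ⟨Equiv.ofBijective _ ((Fintype.bijective_iff_surjective_and_card _).2 ⟨hs, hE⟩),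
      Finset.mem_univ _, rfl⟩

lemma tensorInner_labelTensor_tensorPower {n m : ℕ} (σ : Finset (Fin n) → ℝ)
    (y v : Fin n → ℝ) : tensorInner (labelTensor m σ y) (tensorPower m v) =
      ∑ i : Fin m → Fin n, σ (Finset.univ.image i) * ∏ k, (y * v) (i k) := by
  simp only [tensorInner, labelTensor, tensorPower, mul_assoc, ← Finset.prod_mul_distrib,
    Pi.mul_apply]

lemma tensorInner_labelTensor_tensorPower_eq_sum_edges {n m : ℕ}
    {E : Finset (Finset (Fin n))} (hE : ∀ e ∈ E, e.card = m) {σ : Finset (Fin n) → ℝ}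
    (hσ : ∀ e, e ∉ E → σ e = 0) (y v : Fin n → ℝ) :
    tensorInner (labelTensor m σ y) (tensorPower m v) =
      m.factorial * ∑ e ∈ E, σ e * ∏ a ∈ e, (y * v) a := by
  rw [tensorInner_labelTensor_tensorPower]
  have h1 : ∀ i : Fin m → Fin n, σ (Finset.univ.image i) * ∏ k, (y * v) (i k) =
      σ (Finset.univ.image i) * ∏ a ∈ Finset.univ.image i, (y * v) a := by
    intro i
    by_cases hi : Finset.univ.image i ∈ E
    · have hinj : Set.InjOn i (Finset.univ : Finset (Fin m)) := by
        rw [← Finset.card_image_iff, hE _ hi, Finset.card_univ, Fintype.card_fin]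
      rw [Finset.prod_image hinj]
    · rw [hσ _ hi, zero_mul, zero_mul]
  simp_rw [h1]
  rw [← Finset.sum_fiberwise' Finset.univ (fun i : Fin m → Fin n => Finset.univ.image i)
    (fun e => σ e * ∏ a ∈ e, (y * v) a), Finset.mul_sum]
  simp_rw [Finset.sum_const, nsmul_eq_mul]
  rw [← Finset.sum_subset (Finset.subset_univ E)]
  · exact Finset.sum_congr rfl fun e he => by rw [card_filter_image_eq (hE e he)]
  · intro e _ he
    rw [hσ e he]
    simp

/-- The sets in `E` whose product of labels is `-1`. -/
noncomputable def negativeEdges {n : ℕ} (E : Finset (Finset (Fin n))) (t : Fin n → ℝ) :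
    Finset (Finset (Fin n)) :=
  E.filter fun e => ∏ a ∈ e, t a = -1

lemma tensorInner_lt_of_negativeEdges {n m : ℕ} {E : Finset (Finset (Fin n))}
    (hE : ∀ e ∈ E, e.card = m) {σ : Finset (Fin n) → ℝ} (hσ : ∀ e, e ∉ E → σ e = 0)
    {y s : Fin n → ℝ} (hy : IsSignVector y) (hs : IsSignVector s)
    (h : 0 < ∑ e ∈ negativeEdges E (y * s), σ e) :
    tensorInner (labelTensor m σ y) (tensorPower m s) <
      tensorInner (labelTensor m σ y) (tensorPower m y) := by
  rw [tensorInner_labelTensor_tensorPower_eq_sum_edges hE hσ,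
    tensorInner_labelTensor_tensorPower_eq_sum_edges hE hσ]
  refine mul_lt_mul_of_pos_left ?_ (by exact_mod_cast m.factorial_pos)
  rw [← sub_pos, ← Finset.sum_sub_distrib]
  have : ∑ e ∈ E, (σ e * ∏ a ∈ e, (y * y) a - σ e * ∏ a ∈ e, (y * s) a) =
      2 * ∑ e ∈ negativeEdges E (y * s), σ e := by
    rw [negativeEdges, Finset.sum_filter, Finset.mul_sum]
    refine Finset.sum_congr rfl fun e _ => ?_
    have h1 : ∏ a ∈ e, (y * y) a = 1 := Finset.prod_eq_one fun a _ => hy.mul_self a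
    rw [h1]
    rcases (hy.mul hs).prod_eq_or e id with h | h <;> simp only [id] at h <;> rw [h]
    · norm_num
    · simp; ring
  rw [this]
  linarith

lemma choose_le_card_negativeEdges {n m : ℕ} (hme : Even m) (hm : 0 < m)
    {E : Finset (Finset (Fin n))}
    (hE : ∀ e : Finset (Fin n), e.card = m → e ∈ E) {t : Fin n → ℝ} {c : ℝ} (hc : c ^ 2 = 1)
    (hc0 : c ≠ -c) {a : Fin n} (ha : t a = -c) :
    (Finset.univ.filter fun b => t b = c).card.choose (m - 1) ≤ (negativeEdges E t).card := by
  classical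
  rw [← Finset.card_powersetCard]
  have hna : ∀ f ∈ (Finset.univ.filter fun b => t b = c).powersetCard (m - 1), a ∉ f := by
    intro f hf haf
    have := (Finset.mem_filter.1 ((Finset.mem_powersetCard.1 hf).1 haf)).2
    exact hc0 (this.symm.trans ha)
  refine Finset.card_le_card_of_injOn (fun f => insert a f) ?_ ?_
  · intro f hf
    have hf' := Finset.mem_powersetCard.1 hf
    have hcard : (insert a f).card = m := by
      rw [Finset.card_insert_of_notMem (hna f hf), hf'.2]
      omega
    simp only [negativeEdges, Finset.coe_filter, Set.mem_ofPred_eq]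
    refine ⟨hE _ hcard, ?_⟩
    rw [Finset.prod_insert (hna f hf), ha,
      Finset.prod_congr rfl fun b hb => (Finset.mem_filter.1 (hf'.1 hb)).2, Finset.prod_const,
      hf'.2]
    obtain ⟨l, hl⟩ := hme.two_dvd
    rw [neg_mul, mul_pow_sub_one (by omega), hl, pow_mul, hc, one_pow]
  · intro f hf g hg hfg
    have := congrArg (fun u => u.erase a) hfg
    simpa [Finset.erase_insert (hna f hf), Finset.erase_insert (hna g hg)] using this

lemma sq_div_le_choose {n m h : ℕ} (hm : 3 ≤ m) (hn : 4 * m ≤ n) (hh : n ≤ 2 * h) :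
    (n : ℝ) ^ 2 / (16 * (m - 1).factorial) ≤ h.choose (m - 1) := by
  have hf : (0 : ℝ) < (m - 1).factorial := by exact_mod_cast (m - 1).factorial_pos
  refine le_trans ?_ (Nat.pow_le_choose (m - 1) h)
  have h1 : (n : ℝ) / 4 ≤ (h + 1 - (m - 1) : ℕ) := by
    have : n ≤ 4 * (h + 1 - (m - 1)) := by omega
    have : (n : ℝ) ≤ 4 * (h + 1 - (m - 1) : ℕ) := by exact_mod_cast this
    linarith
  have h2 : (1 : ℝ) ≤ (n : ℝ) / 4 := by
    have : (4 : ℝ) ≤ n := by exact_mod_cast (by omega : 4 ≤ n)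
    linarith
  have h3 : ((n : ℝ) / 4) ^ 2 ≤ ((h + 1 - (m - 1) : ℕ) : ℝ) ^ (m - 1) :=
    (pow_le_pow_right₀ h2 (by omega)).trans (pow_le_pow_left₀ (by positivity) h1 _)
  calc (n : ℝ) ^ 2 / (16 * (m - 1).factorial) = (n / 4 : ℝ) ^ 2 / (m - 1).factorial := by
        field_simp; norm_num
    _ ≤ _ := by gcongr

lemma sq_div_le_card_negativeEdges {n m : ℕ} (hme : Even m) (hm : 3 ≤ m) (hn : 4 * m ≤ n)
    {E : Finset (Finset (Fin n))} (hE : ∀ e : Finset (Fin n), e.card = m → e ∈ E)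
    {t : Fin n → ℝ} (ht : IsSignVector t) {a b : Fin n} (ha : t a = 1) (hb : t b = -1) :
    (n : ℝ) ^ 2 / (16 * (m - 1).factorial) ≤ (negativeEdges E t).card := by
  have hsum : (Finset.univ.filter fun b => t b = 1).card +
      (Finset.univ.filter fun b => t b = -1).card = n := by
    conv_rhs => rw [← Fintype.card_fin n, ← Finset.card_univ,
      ← Finset.card_filter_add_card_filter_not (s := Finset.univ) (fun b => t b = 1)]
    congr 2
    ext x
    rcases ht x with h | h <;> norm_num [h]
  by_cases hh : n ≤ 2 * (Finset.univ.filter fun b => t b = 1).card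
  · refine (sq_div_le_choose hm hn hh).trans ?_
    exact_mod_cast choose_le_card_negativeEdges hme (by omega) hE (by norm_num) (by norm_num) hb
  · refine (sq_div_le_choose hm hn (by omega :
      n ≤ 2 * (Finset.univ.filter fun b => t b = -1).card)).trans ?_
    exact_mod_cast choose_le_card_negativeEdges hme (by omega) hE (c := -1) (by norm_num)
      (by norm_num) (by rw [neg_neg]; exact ha)

/-- For orders at least four, stage one fails with probability at most `C / n`. -/
lemma exists_measureReal_stageOne_failure_le_of_four_le {m : ℕ} (hm4 : 4 ≤ m) (hme : Even m)
    {p : ℝ} (hp0 : 0 ≤ p) (hp : p < 1 / 2) :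
    ∃ C : ℝ, 0 < C ∧ ∃ n₀ : ℕ, ∀ n : ℕ, n₀ ≤ n → ∀ G : UniformHypergraph n m, G.IsComplete →
      ∀ y : Fin n → ℝ, IsSignVector y →
        (Measure.pi fun _ : G.edges => flipLaw p).real
          {ω | ¬ ∀ Y, IsStageOneSolution (labelTensor m (G.edgeSign ω) y) Y ↔
            Y = tensorPower m y} ≤ C / n := by
  classical
  set c : ℝ := (1 - 2 * p) ^ 2 / 8 / (16 * (m - 1).factorial) with hc
  have hδ : 0 < 1 - 2 * p := by linarith
  have hfac : (0 : ℝ) < (m - 1).factorial := by exact_mod_cast (m - 1).factorial_pos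
  have hc0 : 0 < c := by positivity
  obtain ⟨N, hN⟩ := exists_nat_ge (2 / c)
  refine ⟨1, one_pos, max N (4 * m), fun n hn G hG y hy => ?_⟩
  have hnN : N ≤ n := (le_max_left _ _).trans hn
  have hn4 : 4 * m ≤ n := (le_max_right _ _).trans hn
  have hn0 : 0 < n := by omega
  have := isProbabilityMeasure_flipLaw hp0 (by linarith : p ≤ 1)
  set μ := Measure.pi fun _ : G.edges => flipLaw p with hμ
  have : IsProbabilityMeasure μ := by rw [hμ]; infer_instance
  let t : Finset (Fin n) → Fin n → ℝ := fun A a => if a ∈ A then -1 else 1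
  let I : Finset (Finset (Fin n)) := Finset.univ.filter fun A => A.Nonempty ∧ A ≠ Finset.univ
  let B : Finset (Fin n) → Set (G.edges → Bool) := fun A =>
    {ω | ∑ e ∈ negativeEdges G.edges (t A), G.edgeSign ω e ≤
      (1 - 2 * p) / 2 * (negativeEdges G.edges (t A)).card}
  have hsub : {ω | ¬ ∀ Y, IsStageOneSolution (labelTensor m (G.edgeSign ω) y) Y ↔
      Y = tensorPower m y} ⊆ ⋃ A ∈ I, B A := by
    intro ω hω
    by_contra hnot
    apply hω
    refine isStageOneSolution_iff_of_sign_vectors hn0 hm4 hme hy fun s hs hne => ?_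
    refine tensorInner_lt_of_negativeEdges G.card_eq (fun e => G.edgeSign_of_notMem ω) hy hs ?_
    set A : Finset (Fin n) := Finset.univ.filter fun a => (y * s) a = -1 with hA
    have hys : y * s = t A := by
      funext a
      by_cases h : (y * s) a = -1
      · rw [h]
        exact (if_pos (Finset.mem_filter.2 ⟨Finset.mem_univ a, h⟩)).symm
      · simp only [t, hA, Finset.mem_filter, Finset.mem_univ, true_and, h, if_false]
        exact ((hy.mul hs) a).resolve_right h
    have hyys : y * (y * s) = s := by
      funext a
      simp only [Pi.mul_apply, ← mul_assoc, hy.mul_self, one_mul]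
    have hAI : A ∈ I := by
      simp only [I, Finset.mem_filter, Finset.mem_univ, true_and]
      constructor
      · rw [Finset.nonempty_iff_ne_empty]
        intro h0
        apply hne
        rw [← hyys, hys, h0]
        congr 1
        funext a
        simp [t]
      · intro h0
        apply hne
        rw [← hyys, hys, h0, ← tensorPower_neg hme y]
        congr 1
        funext a
        simp [t]
    have hnB : ω ∉ B A := fun h => hnot (Set.mem_biUnion hAI h)
    simp only [B, Set.mem_ofPred_eq, not_le] at hnB
    rw [hys]
    exact lt_of_le_of_lt (mul_nonneg (by linarith) (Nat.cast_nonneg _)) hnB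
  have hB : ∀ A ∈ I, μ.real (B A) ≤ Real.exp (-c * n ^ 2) := by
    intro A hA
    simp only [I, Finset.mem_filter, Finset.mem_univ, true_and] at hA
    obtain ⟨b, hb⟩ := hA.1
    obtain ⟨a, ha⟩ : ∃ a, a ∉ A := by
      by_contra! h
      exact hA.2 (Finset.eq_univ_of_forall h)
    have hcard := sq_div_le_card_negativeEdges hme (by omega) hn4 hG (t := t A) (a := a) (b := b)
      (fun a => by simp only [t]; split_ifs <;> simp) (if_neg ha) (if_pos hb)
    refine (G.measureReal_sum_edgeSign_le hp0 hp (Finset.filter_subset _ _)).trans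
      (Real.exp_le_exp.2 ?_)
    have h8 : 0 ≤ (1 - 2 * p) ^ 2 / 8 := by positivity
    have := mul_le_mul_of_nonneg_left hcard h8
    have heq : c * (n : ℝ) ^ 2 =
        (1 - 2 * p) ^ 2 / 8 * ((n : ℝ) ^ 2 / (16 * (m - 1).factorial)) := by
      rw [hc]; field_simp
    rw [neg_mul, neg_mul, heq]
    exact neg_le_neg this
  have hn1 : (0 : ℝ) < n := by exact_mod_cast hn0
  calc μ.real _ ≤ μ.real (⋃ A ∈ I, B A) := measureReal_mono hsub (measure_ne_top μ _)
    _ ≤ ∑ A ∈ I, μ.real (B A) := measureReal_biUnion_finset_le _ _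
    _ ≤ ∑ A ∈ I, Real.exp (-c * n ^ 2) := Finset.sum_le_sum hB
    _ ≤ ∑ A : Finset (Fin n), Real.exp (-c * n ^ 2) :=
        Finset.sum_le_sum_of_subset_of_nonneg (Finset.subset_univ _)
          fun _ _ _ => (Real.exp_pos _).le
    _ = 2 ^ n * Real.exp (-c * n ^ 2) := by simp
    _ ≤ Real.exp n * Real.exp (-(2 * n)) := by
        gcongr
        · rw [← mul_one (n : ℝ), Real.exp_nat_mul]
          gcongr
          linarith [Real.add_one_le_exp (1 : ℝ)]
        · have : 2 ≤ c * n := by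
            rw [← div_le_iff₀' hc0]
            exact hN.trans (by exact_mod_cast hnN)
          nlinarith
    _ = Real.exp (-1 * n) := by rw [← Real.exp_add]; ring_nf
    _ ≤ 1 / 1 / n := exp_neg_mul_natCast_le one_pos hn0
    _ = 1 / n := by rw [div_one]

section QuadraticForms

variable {ι : Type*} [Fintype ι]

lemma sq_bilinear_sum_le (M : ι → ι → ℝ) (u : ι → ℝ) :
    (∑ a, ∑ b, M a b * u a * u b) ^ 2 ≤ (∑ a, ∑ b, M a b ^ 2) * (∑ a, u a ^ 2) ^ 2 := by
  have h := Finset.sum_mul_sq_le_sq_mul_sq (Finset.univ : Finset (ι × ι))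
    (fun x => M x.1 x.2) (fun x => u x.1 * u x.2)
  simp only [Fintype.sum_prod_type] at h
  have h2 : ∑ a, ∑ b, (u a * u b) ^ 2 = (∑ a, u a ^ 2) ^ 2 := by
    rw [sq (∑ a, u a ^ 2), Finset.sum_mul_sum]
    simp_rw [mul_pow]
  rw [h2] at h
  simpa only [mul_assoc] using h

/-- The fourth power of a quadratic form is controlled by the Frobenius norm of the square of
its matrix. -/
lemma quadratic_form_pow_four_le (W : ι → ι → ℝ) (u : ι → ℝ) :
    (∑ k, ∑ a, W k a * u k * u a) ^ 4 ≤
      (∑ a, ∑ b, (∑ k, W k a * W k b) ^ 2) * (∑ a, u a ^ 2) ^ 4 := by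
  set q := ∑ a, u a ^ 2 with hq
  set G := ∑ a, ∑ b, (∑ k, W k a * W k b) * u a * u b with hG
  have h1 : (∑ k, ∑ a, W k a * u k * u a) ^ 2 ≤ q * G := by
    have h := Finset.sum_mul_sq_le_sq_mul_sq (Finset.univ : Finset ι) u
      (fun k => ∑ a, W k a * u a)
    have e1 : ∑ k, u k * ∑ a, W k a * u a = ∑ k, ∑ a, W k a * u k * u a := by
      simp_rw [Finset.mul_sum]
      exact Finset.sum_congr rfl fun k _ => Finset.sum_congr rfl fun a _ => by ring
    have e2 : ∑ k, (∑ a, W k a * u a) ^ 2 = G := by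
      simp_rw [hG, sq, Finset.sum_mul_sum, Finset.sum_mul]
      rw [Finset.sum_comm]
      refine Finset.sum_congr rfl fun a _ => ?_
      rw [Finset.sum_comm]
      exact Finset.sum_congr rfl fun b _ => Finset.sum_congr rfl fun k _ => by ring
    rwa [e1, e2] at h
  have h2 : G ^ 2 ≤ (∑ a, ∑ b, (∑ k, W k a * W k b) ^ 2) * q ^ 2 := sq_bilinear_sum_le _ u
  calc (∑ k, ∑ a, W k a * u k * u a) ^ 4 = ((∑ k, ∑ a, W k a * u k * u a) ^ 2) ^ 2 := by ring
    _ ≤ (q * G) ^ 2 := pow_le_pow_left₀ (sq_nonneg _) h1 2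
    _ = q ^ 2 * G ^ 2 := by ring
    _ ≤ q ^ 2 * ((∑ a, ∑ b, (∑ k, W k a * W k b) ^ 2) * q ^ 2) := by gcongr
    _ = _ := by ring

lemma quadratic_form_le_of_frobenius_lt {W : ι → ι → ℝ} {κ : ℝ} (hκ : 0 ≤ κ)
    (hW : ∑ a, ∑ b, (∑ k, W k a * W k b) ^ 2 < κ ^ 4) (u : ι → ℝ) :
    ∑ k, ∑ a, W k a * u k * u a ≤ κ * ∑ a, u a ^ 2 := by
  have hq : 0 ≤ ∑ a, u a ^ 2 := Finset.sum_nonneg fun a _ => sq_nonneg _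
  by_contra! h
  have h1 := pow_lt_pow_left₀ h (mul_nonneg hκ hq) (by norm_num : 4 ≠ 0)
  have h2 := quadratic_form_pow_four_le W u
  have h3 := mul_le_mul_of_nonneg_right hW.le (pow_nonneg hq 4)
  rw [mul_pow] at h1
  linarith

/-- The quadratic form of the signed graph Laplacian with weights `S`. -/
def laplacianForm (S : ι → ι → ℝ) (w : ι → ℝ) : ℝ :=
  ∑ a, (∑ b, S a b) * w a ^ 2 - ∑ a, ∑ b, S a b * w a * w b

lemma laplacianForm_eq {S : ι → ι → ℝ} (hS : ∀ a b, S a b = S b a) (w : ι → ℝ) :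
    laplacianForm S w = (∑ a, ∑ b, S a b * (w a - w b) ^ 2) / 2 := by
  have h1 : ∑ a, ∑ b, S a b * w b ^ 2 = ∑ a, (∑ b, S a b) * w a ^ 2 := by
    rw [Finset.sum_comm]
    simp_rw [Finset.sum_mul]
    exact Finset.sum_congr rfl fun a _ => Finset.sum_congr rfl fun b _ => by rw [hS b a]
  have h2 : ∑ a, ∑ b, S a b * (w a - w b) ^ 2 = ∑ a, (∑ b, S a b) * w a ^ 2 +
      ∑ a, ∑ b, S a b * w b ^ 2 - 2 * ∑ a, ∑ b, S a b * w a * w b := by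
    simp_rw [Finset.sum_mul, Finset.mul_sum, ← Finset.sum_add_distrib, ← Finset.sum_sub_distrib]
    exact Finset.sum_congr rfl fun a _ => Finset.sum_congr rfl fun b _ => by ring
  rw [h2, h1, laplacianForm]
  ring

lemma laplacianForm_sub_const {S : ι → ι → ℝ} (hS : ∀ a b, S a b = S b a) (w : ι → ℝ) (c : ℝ) :
    laplacianForm S (fun a => w a - c) = laplacianForm S w := by
  rw [laplacianForm_eq hS, laplacianForm_eq hS]
  simp only [sub_sub_sub_cancel_right]

/-- The off-diagonal part of `S` centered at `δ`. -/
noncomputable def centeredOffDiag (S : ι → ι → ℝ) (δ : ℝ) (a b : ι) : ℝ :=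
  open Classical in if a = b then 0 else S a b - δ

lemma laplacianForm_ge_of_sum_eq_zero {S : ι → ι → ℝ} (hd : ∀ a, S a a = 0) {δ κ ρ : ℝ}
    (hρ : ∀ a, ρ ≤ ∑ b, S a b)
    (hW : ∀ u : ι → ℝ, ∑ k, ∑ a, centeredOffDiag S δ k a * u k * u a ≤ κ * ∑ a, u a ^ 2)
    {u : ι → ℝ} (hu : ∑ a, u a = 0) : (ρ + δ - κ) * ∑ a, u a ^ 2 ≤ laplacianForm S u := by
  classical
  have h1 : ρ * ∑ a, u a ^ 2 ≤ ∑ a, (∑ b, S a b) * u a ^ 2 := by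
    rw [Finset.mul_sum]
    exact Finset.sum_le_sum fun a _ => mul_le_mul_of_nonneg_right (hρ a) (sq_nonneg _)
  have h2 : ∑ a, ∑ b, S a b * u a * u b =
      ∑ a, ∑ b, centeredOffDiag S δ a b * u a * u b - δ * ∑ a, u a ^ 2 := by
    have h3 : ∀ a b, S a b * u a * u b = centeredOffDiag S δ a b * u a * u b +
        δ * (u a * u b) - if a = b then δ * u b ^ 2 else 0 := by
      intro a b
      unfold centeredOffDiag
      split_ifs with h
      · subst h; rw [hd]; ring
      · ring
    have h4 : ∑ a, ∑ b, δ * (u a * u b) = 0 := by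
      simp_rw [← Finset.mul_sum, hu]
      simp
    simp_rw [h3, Finset.sum_sub_distrib, Finset.sum_add_distrib, h4]
    simp [Finset.mul_sum]
  have := hW u
  rw [laplacianForm, h2]
  linarith

/-- A spectral gap: large row sums and a small centered part make the Laplacian form positive
on nonconstant vectors. -/
lemma laplacianForm_nonneg_and_eq_of_eq_zero {S : ι → ι → ℝ} (hS : ∀ a b, S a b = S b a)
    (hd : ∀ a, S a a = 0) {δ κ ρ : ℝ} (hρ : ∀ a, ρ ≤ ∑ b, S a b)
    (hW : ∀ u : ι → ℝ, ∑ k, ∑ a, centeredOffDiag S δ k a * u k * u a ≤ κ * ∑ a, u a ^ 2)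
    (hpos : 0 < ρ + δ - κ) (w : ι → ℝ) :
    0 ≤ laplacianForm S w ∧ (laplacianForm S w = 0 → ∀ a b, w a = w b) := by
  rcases isEmpty_or_nonempty ι with hι | hι
  · exact ⟨by simp [laplacianForm], fun _ a => hι.elim a⟩
  set c := (∑ a, w a) / Fintype.card ι with hc
  have hu : ∑ a, (w a - c) = 0 := by
    rw [Finset.sum_sub_distrib, Finset.sum_const, Finset.card_univ, nsmul_eq_mul, hc,
      mul_div_cancel₀ _ (by exact_mod_cast Fintype.card_ne_zero), sub_self]
  have key := laplacianForm_ge_of_sum_eq_zero hd hρ hW hu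
  rw [laplacianForm_sub_const hS] at key
  have hq : 0 ≤ ∑ a, (w a - c) ^ 2 := Finset.sum_nonneg fun a _ => sq_nonneg _
  refine ⟨(mul_nonneg hpos.le hq).trans key, fun h0 => ?_⟩
  have hq0 : ∑ a, (w a - c) ^ 2 = 0 := by
    rw [h0] at key
    nlinarith
  have hz := (Finset.sum_eq_zero_iff_of_nonneg fun a _ => sq_nonneg (w a - c)).1 hq0
  have hz' : ∀ a, w a = c := fun a => by
    have := pow_eq_zero_iff (two_ne_zero) |>.1 (hz a (Finset.mem_univ a))
    linarith
  intro a b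
  rw [hz' a, hz' b]

end QuadraticForms

lemma tensorInner_labelTensor_two {n : ℕ} (σ : Finset (Fin n) → ℝ) (y v : Fin n → ℝ) :
    tensorInner (labelTensor 2 σ y) (tensorPower 2 v) =
      ∑ a, ∑ b, σ {a, b} * (y * v) a * (y * v) b := by
  rw [tensorInner_labelTensor_tensorPower, ← Fintype.sum_prod_type'
    (fun a b => σ {a, b} * (y * v) a * (y * v) b)]
  refine Fintype.sum_equiv (finTwoArrowEquiv _) _ _ fun i => ?_
  have : Finset.univ.image i = {i 0, i 1} := by
    ext a
    simp [Fin.exists_fin_two, eq_comm]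
  rw [this, Fin.prod_univ_two]
  simp [mul_assoc]

/-- For matrices, the program of stage one is decided by the Laplacian form of the signs. -/
lemma isStageOneSolution_iff_of_laplacianForm {n : ℕ} (hn : 0 < n) {σ : Finset (Fin n) → ℝ}
    {y : Fin n → ℝ} (hy : IsSignVector y)
    (hL : ∀ w : Fin n → ℝ, 0 ≤ laplacianForm (fun a b => σ {a, b}) w ∧
      (laplacianForm (fun a b => σ {a, b}) w = 0 → ∀ a b, w a = w b)) :
    ∀ Y, IsStageOneSolution (labelTensor 2 σ y) Y ↔ Y = tensorPower 2 y := by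
  refine isStageOneSolution_iff_of_forall_lt
    (tensorPower_mem_stageOneFeasible hn two_pos hy) ?_
  rintro _ ⟨⟨v, rfl⟩, -, hev⟩ hle
  have hdiag : ∀ a, ∑ j, v j a ^ 2 = 1 := fun a => by
    simpa using sum_pow_mul_pow_eq_one le_rfl even_two even_two hev a a
  have hsum : ∑ j, laplacianForm (fun a b => σ {a, b}) (y * v j) =
      tensorInner (labelTensor 2 σ y) (tensorPower 2 y) -
        tensorInner (labelTensor 2 σ y) (∑ j, tensorPower 2 (v j)) := by
    rw [tensorInner_sum_right]
    simp_rw [tensorInner_labelTensor_two, laplacianForm]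
    rw [Finset.sum_sub_distrib]
    congr 1
    rw [Finset.sum_comm]
    refine Finset.sum_congr rfl fun a _ => ?_
    rw [← Finset.mul_sum]
    simp_rw [Pi.mul_apply, mul_pow, hy.sq_eq_one, one_mul, hdiag, hy.mul_self, mul_one]
  have h0 : ∑ j, laplacianForm (fun a b => σ {a, b}) (y * v j) = 0 :=
    le_antisymm (by rw [hsum]; linarith) (Finset.sum_nonneg fun j _ => (hL _).1)
  have hz := (Finset.sum_eq_zero_iff_of_nonneg fun j _ => (hL (y * v j)).1).1 h0
  have hv : ∀ j, v j = (y ⟨0, hn⟩ * v j ⟨0, hn⟩) • y := by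
    intro j
    funext a
    have := (hL _).2 (hz j (Finset.mem_univ j)) a ⟨0, hn⟩
    simp only [Pi.mul_apply] at this
    rw [Pi.smul_apply, smul_eq_mul, ← this, mul_right_comm, hy.mul_self, one_mul]
  calc ∑ j, tensorPower 2 (v j) = ∑ j, (v j ⟨0, hn⟩ ^ 2) • tensorPower 2 y := by
        refine Finset.sum_congr rfl fun j _ => ?_
        conv_lhs => rw [hv j]
        rw [tensorPower_smul, mul_pow, hy.sq_eq_one, one_mul]
    _ = tensorPower 2 y := by rw [← Finset.sum_smul, hdiag, one_smul]

namespace UniformHypergraph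

variable {n : ℕ} (G : UniformHypergraph n 2)

lemma pair_mem_edges (hG : G.IsComplete) {a b : Fin n} (hab : a ≠ b) :
    ({a, b} : Finset (Fin n)) ∈ G.edges := hG _ (Finset.card_pair hab)

lemma edgeSign_pair_self (ω : G.edges → Bool) (a : Fin n) : G.edgeSign ω {a, a} = 0 := by
  refine G.edgeSign_of_notMem ω fun h => ?_
  simpa using G.card_eq _ h

lemma measureReal_rowSum_le (hG : G.IsComplete) {p : ℝ} (h0 : 0 ≤ p) (h1 : p < 1 / 2)
    (a : Fin n) :
    (Measure.pi fun _ : G.edges => flipLaw p).real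
      {ω | ∑ b, G.edgeSign ω {a, b} ≤ (1 - 2 * p) / 2 * (n - 1 : ℕ)} ≤
      Real.exp (-((1 - 2 * p) ^ 2 / 8) * (n - 1 : ℕ)) := by
  classical
  set T : Finset (Finset (Fin n)) := (Finset.univ.erase a).image fun b => {a, b} with hT
  have hinj : Set.InjOn (fun b : Fin n => ({a, b} : Finset (Fin n))) (Finset.univ.erase a) := by
    intro b hb c hc hbc
    have hb' : b ≠ a := Finset.ne_of_mem_erase hb
    have : b ∈ ({a, c} : Finset (Fin n)) := by
      rw [← show ({a, b} : Finset (Fin n)) = {a, c} from hbc]; simp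
    simpa [hb'] using this
  have hcard : T.card = n - 1 := by
    rw [hT, Finset.card_image_of_injOn hinj, Finset.card_erase_of_mem (Finset.mem_univ a),
      Finset.card_univ, Fintype.card_fin]
  have hTE : T ⊆ G.edges := by
    intro e he
    obtain ⟨b, hb, rfl⟩ := Finset.mem_image.1 he
    exact G.pair_mem_edges hG (Finset.ne_of_mem_erase hb).symm
  have hsum : ∀ ω, ∑ e ∈ T, G.edgeSign ω e = ∑ b, G.edgeSign ω {a, b} := by
    intro ω
    rw [hT, Finset.sum_image hinj, ← Finset.add_sum_erase _ _ (Finset.mem_univ a),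
      G.edgeSign_pair_self, zero_add]
  have := G.measureReal_sum_edgeSign_le h0 h1 hTE
  simp_rw [hsum, hcard] at this
  exact this

/-- The centered adjacency matrix of the noise signs of a graph. -/
noncomputable def centeredSigns (p : ℝ) (ω : G.edges → Bool) : Fin n → Fin n → ℝ :=
  centeredOffDiag (fun a b => G.edgeSign ω {a, b}) (1 - 2 * p)

lemma centeredSigns_self (p : ℝ) (ω : G.edges → Bool) (a : Fin n) :
    G.centeredSigns p ω a a = 0 := if_pos rfl

lemma centeredSigns_of_ne (p : ℝ) (ω : G.edges → Bool) {a b : Fin n} (h : a ≠ b) :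
    G.centeredSigns p ω a b = G.edgeSign ω {a, b} - (1 - 2 * p) := if_neg h

lemma abs_centeredSigns_le (hG : G.IsComplete) {p : ℝ} (h0 : 0 ≤ p) (h1 : p ≤ 1)
    (ω : G.edges → Bool) (a b : Fin n) : |G.centeredSigns p ω a b| ≤ 2 := by
  by_cases h : a = b
  · rw [h, centeredSigns_self]; simp
  · rw [G.centeredSigns_of_ne p ω h, abs_le]
    rcases G.edgeSign_eq_or ω (G.pair_mem_edges hG h) with h | h <;> rw [h] <;>
      constructor <;> linarith

lemma integral_centeredSigns_cycle_eq_zero (hG : G.IsComplete) {p : ℝ} (h0 : 0 ≤ p) (h1 : p ≤ 1)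
    {a b k l : Fin n} (hab : a ≠ b) (hkl : k ≠ l) :
    ∫ ω, G.centeredSigns p ω k a * G.centeredSigns p ω k b *
      (G.centeredSigns p ω l a * G.centeredSigns p ω l b)
        ∂(Measure.pi fun _ : G.edges => flipLaw p) = 0 := by
  classical
  by_cases hka : k = a
  · simp [hka, centeredSigns_self]
  by_cases hkb : k = b
  · simp [hkb, centeredSigns_self]
  by_cases hla : l = a
  · simp [hla, centeredSigns_self]
  by_cases hlb : l = b
  · simp [hlb, centeredSigns_self]
  have hT : ({{k, a}, {k, b}, {l, a}, {l, b}} : Finset (Finset (Fin n))) ⊆ G.edges := by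
    intro e he
    simp only [Finset.mem_insert, Finset.mem_singleton] at he
    rcases he with rfl | rfl | rfl | rfl
    · exact G.pair_mem_edges hG hka
    · exact G.pair_mem_edges hG hkb
    · exact G.pair_mem_edges hG hla
    · exact G.pair_mem_edges hG hlb
  rw [← G.integral_prod_centered_edgeSign h0 h1 hT (Finset.insert_nonempty _ _)]
  congr 1
  funext ω
  have hne : ∀ {s t : Finset (Fin n)} (x : Fin n), x ∈ s → x ∉ t → s ≠ t :=
    fun x hs ht h => ht (h ▸ hs)
  rw [Finset.prod_insert, Finset.prod_insert, Finset.prod_insert, Finset.prod_singleton,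
    G.centeredSigns_of_ne p ω hka, G.centeredSigns_of_ne p ω hkb,
    G.centeredSigns_of_ne p ω hla, G.centeredSigns_of_ne p ω hlb]
  · ring
  · simp only [Finset.mem_singleton]
    exact hne a (by simp) (by simp [hab, Ne.symm hla])
  · simp only [Finset.mem_insert, Finset.mem_singleton, not_or]
    exact ⟨hne k (by simp) (by simp [hkl, hka]), hne k (by simp) (by simp [hkl, hkb])⟩
  · simp only [Finset.mem_insert, Finset.mem_singleton, not_or]
    exact ⟨hne a (by simp) (by simp [hab, Ne.symm hka]),
      hne k (by simp) (by simp [hkl, hka]), hne k (by simp) (by simp [hkl, hkb])⟩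

lemma integral_frobenius_centeredSigns_le (hG : G.IsComplete) {p : ℝ} (h0 : 0 ≤ p) (h1 : p ≤ 1) :
    ∫ ω, ∑ a, ∑ b, (∑ k, G.centeredSigns p ω k a * G.centeredSigns p ω k b) ^ 2
      ∂(Measure.pi fun _ : G.edges => flipLaw p) ≤ 32 * (n : ℝ) ^ 3 := by
  classical
  have := isProbabilityMeasure_flipLaw h0 h1
  have hexp : ∀ ω, ∑ a, ∑ b, (∑ k, G.centeredSigns p ω k a * G.centeredSigns p ω k b) ^ 2 =
      ∑ a, ∑ b, ∑ k, ∑ l, G.centeredSigns p ω k a * G.centeredSigns p ω k b *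
        (G.centeredSigns p ω l a * G.centeredSigns p ω l b) := by
    intro ω
    simp_rw [sq, Finset.sum_mul_sum]
  have hterm : ∀ a b k l : Fin n, ∫ ω, G.centeredSigns p ω k a * G.centeredSigns p ω k b *
      (G.centeredSigns p ω l a * G.centeredSigns p ω l b)
        ∂(Measure.pi fun _ : G.edges => flipLaw p) ≤
      (if a = b then 16 else 0) + (if k = l then 16 else 0) := by
    intro a b k l
    by_cases hab : a = b ∨ k = l
    · have h16 : (16 : ℝ) ≤ (if a = b then 16 else 0) + (if k = l then 16 else 0) := by
        split_ifs <;> simp_all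
      refine le_trans ?_ h16
      calc _ ≤ ∫ _, (16 : ℝ) ∂(Measure.pi fun _ : G.edges => flipLaw p) := by
            refine integral_mono Integrable.of_finite (integrable_const _) fun ω => ?_
            refine (le_abs_self _).trans ?_
            rw [abs_mul, abs_mul, abs_mul]
            have := G.abs_centeredSigns_le hG h0 h1 ω
            calc _ ≤ (2 * 2 * (2 * 2) : ℝ) := by
                  gcongr <;> apply this
              _ = 16 := by norm_num
        _ = 16 := by simp
    · rw [not_or] at hab
      rw [G.integral_centeredSigns_cycle_eq_zero hG h0 h1 hab.1 hab.2]
      split_ifs <;> norm_num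
  simp_rw [hexp]
  simp_rw [integral_finsetSum _ fun _ _ => Integrable.of_finite]
  refine (Finset.sum_le_sum fun a _ => Finset.sum_le_sum fun b _ => Finset.sum_le_sum fun k _ =>
    Finset.sum_le_sum fun l _ => hterm a b k l).trans (le_of_eq ?_)
  simp only [Finset.sum_add_distrib, Finset.sum_const, Finset.card_univ, Fintype.card_fin,
    Finset.sum_ite_eq, Finset.mem_univ, if_true, nsmul_eq_mul, ← Finset.mul_sum]
  ring

lemma measureReal_frobenius_centeredSigns_ge_le (hn : 0 < n) (hG : G.IsComplete) {p : ℝ}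
    (h0 : 0 ≤ p) (h1 : p < 1 / 2) :
    (Measure.pi fun _ : G.edges => flipLaw p).real
      {ω | ((1 - 2 * p) / 4 * n) ^ 4 ≤
        ∑ a, ∑ b, (∑ k, G.centeredSigns p ω k a * G.centeredSigns p ω k b) ^ 2} ≤
      32 / ((1 - 2 * p) / 4) ^ 4 / n := by
  have := isProbabilityMeasure_flipLaw h0 (by linarith : p ≤ 1)
  have hδ : 0 < 1 - 2 * p := by linarith
  have hn' : (0 : ℝ) < n := by exact_mod_cast hn
  have hM := mul_meas_ge_le_integral_of_nonneg
    (μ := Measure.pi fun _ : G.edges => flipLaw p)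
    (f := fun ω => ∑ a, ∑ b, (∑ k, G.centeredSigns p ω k a * G.centeredSigns p ω k b) ^ 2)
    (ae_of_all _ fun ω => Finset.sum_nonneg fun a _ => Finset.sum_nonneg fun b _ => sq_nonneg _)
    Integrable.of_finite (((1 - 2 * p) / 4 * n) ^ 4)
  have hM' := hM.trans (G.integral_frobenius_centeredSigns_le hG h0 (by linarith))
  rw [← le_div_iff₀' (by positivity)] at hM'
  refine hM'.trans (le_of_eq ?_)
  field_simp

end UniformHypergraph

/-- For matrices, stage one fails with probability at most `C / n`. -/
lemma exists_measureReal_stageOne_failure_le_two {p : ℝ} (hp0 : 0 ≤ p) (hp : p < 1 / 2) :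
    ∃ C : ℝ, 0 < C ∧ ∃ n₀ : ℕ, ∀ n : ℕ, n₀ ≤ n → ∀ G : UniformHypergraph n 2, G.IsComplete →
      ∀ y : Fin n → ℝ, IsSignVector y →
        (Measure.pi fun _ : G.edges => flipLaw p).real
          {ω | ¬ ∀ Y, IsStageOneSolution (labelTensor 2 (G.edgeSign ω) y) Y ↔
            Y = tensorPower 2 y} ≤ C / n := by
  have hδ : 0 < 1 - 2 * p := by linarith
  set c : ℝ := (1 - 2 * p) ^ 2 / 16 with hc
  have hc0 : 0 < c := by positivity
  refine ⟨2 / c ^ 2 + 32 / ((1 - 2 * p) / 4) ^ 4, by positivity, 2, fun n hn G hG y hy => ?_⟩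
  have hn0 : 0 < n := by omega
  have hn2 : (2 : ℝ) ≤ n := by exact_mod_cast hn
  have hn1 : ((n - 1 : ℕ) : ℝ) = n - 1 := by
    rw [Nat.cast_sub (by omega), Nat.cast_one]
  have := isProbabilityMeasure_flipLaw hp0 (by linarith : p ≤ 1)
  set μ := Measure.pi fun _ : G.edges => flipLaw p with hμ
  have : IsProbabilityMeasure μ := by rw [hμ]; infer_instance
  let R : Fin n → Set (G.edges → Bool) := fun a =>
    {ω | ∑ b, G.edgeSign ω {a, b} ≤ (1 - 2 * p) / 2 * (n - 1 : ℕ)}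
  let F : Set (G.edges → Bool) := {ω | ((1 - 2 * p) / 4 * n) ^ 4 ≤
    ∑ a, ∑ b, (∑ k, G.centeredSigns p ω k a * G.centeredSigns p ω k b) ^ 2}
  have hsub : {ω | ¬ ∀ Y, IsStageOneSolution (labelTensor 2 (G.edgeSign ω) y) Y ↔
      Y = tensorPower 2 y} ⊆ (⋃ a ∈ (Finset.univ : Finset (Fin n)), R a) ∪ F := by
    intro ω hω
    by_contra hnot
    rw [Set.mem_union, not_or] at hnot
    apply hω
    have hR : ∀ a, (1 - 2 * p) / 2 * (n - 1 : ℕ) ≤ ∑ b, G.edgeSign ω {a, b} := by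
      intro a
      by_contra! h
      exact hnot.1 (Set.mem_biUnion (Finset.mem_univ a) h.le)
    have hF := hnot.2
    simp only [F, Set.mem_ofPred_eq, not_le] at hF
    refine isStageOneSolution_iff_of_laplacianForm hn0 hy
      (laplacianForm_nonneg_and_eq_of_eq_zero (fun a b => by rw [Finset.pair_comm])
        (G.edgeSign_pair_self ω) hR
        (quadratic_form_le_of_frobenius_lt (mul_nonneg (by linarith) (by linarith)) hF) ?_)
    rw [hn1]
    nlinarith
  have hRle : ∀ a ∈ (Finset.univ : Finset (Fin n)), μ.real (R a) ≤ Real.exp (-c * n) := by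
    intro a _
    refine (G.measureReal_rowSum_le hG hp0 hp a).trans (Real.exp_le_exp.2 ?_)
    rw [hn1, hc]
    nlinarith [sq_nonneg (1 - 2 * p)]
  calc μ.real _ ≤ μ.real ((⋃ a ∈ (Finset.univ : Finset (Fin n)), R a) ∪ F) :=
        measureReal_mono hsub (measure_ne_top μ _)
    _ ≤ μ.real (⋃ a ∈ (Finset.univ : Finset (Fin n)), R a) + μ.real F :=
        measureReal_union_le _ _
    _ ≤ ∑ a : Fin n, μ.real (R a) + μ.real F := by
        gcongr
        exact measureReal_biUnion_finset_le _ _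
    _ ≤ ∑ _a : Fin n, Real.exp (-c * n) + 32 / ((1 - 2 * p) / 4) ^ 4 / n :=
        add_le_add (Finset.sum_le_sum hRle)
          (G.measureReal_frobenius_centeredSigns_ge_le hn0 hG hp0 hp)
    _ = n * Real.exp (-c * n) + 32 / ((1 - 2 * p) / 4) ^ 4 / n := by simp
    _ ≤ 2 / c ^ 2 / n + 32 / ((1 - 2 * p) / 4) ^ 4 / n := by
        gcongr
        exact natCast_mul_exp_neg_mul_natCast_le hc0 hn0
    _ = _ := by rw [← add_div]

/-- The node observations fail to separate the two candidate labelings with probability at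
most `C / n`. -/
lemma measureReal_nodeObservation_le {q : ℝ} (hq0 : 0 ≤ q) (hq : q < 1 / 2) {n : ℕ}
    (hn : 0 < n) :
    (Measure.pi fun _ : Fin n => flipLaw q).real {ω | ∑ i, flipSign (ω i) ≤ 0} ≤
      1 / ((1 - 2 * q) ^ 2 / 8) / n := by
  have hδ : 0 < 1 - 2 * q := by linarith
  have := isProbabilityMeasure_flipLaw hq0 (by linarith : q ≤ 1)
  have h := measureReal_sum_flipSign_le hq0 hq (Finset.univ : Finset (Fin n))
  rw [Finset.card_univ, Fintype.card_fin] at h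
  refine (measureReal_mono (fun ω hω => ?_) (measure_ne_top _ _)).trans
    (h.trans (exp_neg_mul_natCast_le (by positivity) hn))
  simp only [Set.mem_ofPred_eq] at hω ⊢
  exact hω.trans (mul_nonneg (by linarith) (Nat.cast_nonneg n))

lemma UniformHypergraph.one_sub_le_successProb {n m : ℕ} (hn : 0 < n) (hm : 0 < m)
    (hme : Even m) (G : UniformHypergraph n m) {p q : ℝ} (hp0 : 0 ≤ p) (hp : p < 1 / 2)
    (hq0 : 0 ≤ q) (hq : q < 1 / 2) {y : Fin n → ℝ} (hy : IsSignVector y) :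
    1 - ((Measure.pi fun _ : G.edges => flipLaw p).real
        {ω | ¬ ∀ Y, IsStageOneSolution (labelTensor m (G.edgeSign ω) y) Y ↔
          Y = tensorPower m y} +
      (Measure.pi fun _ : Fin n => flipLaw q).real {ω | ∑ i, flipSign (ω i) ≤ 0}) ≤
      G.successProb p q y := by
  have := isProbabilityMeasure_flipLaw hp0 (by linarith : p ≤ 1)
  have := isProbabilityMeasure_flipLaw hq0 (by linarith : q ≤ 1)
  have : IsProbabilityMeasure (G.noiseLaw p q) := by unfold noiseLaw; infer_instance
  set A := {ω | ¬ ∀ Y, IsStageOneSolution (labelTensor m (G.edgeSign ω) y) Y ↔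
    Y = tensorPower m y} with hA
  set B := {ω : Fin n → Bool | ∑ i, flipSign (ω i) ≤ 0} with hB
  set S : Set G.Noise :=
    {ω | ExactInference (G.hyperedgeObservation y ω) (G.nodeObservation y ω) y} with hS
  have hA' : (G.noiseLaw p q).real (A ×ˢ Set.univ) =
      (Measure.pi fun _ : G.edges => flipLaw p).real A := by
    simp [noiseLaw, measureReal_prod_prod]
  have hB' : (G.noiseLaw p q).real (Set.univ ×ˢ B) =
      (Measure.pi fun _ : Fin n => flipLaw q).real B := by
    simp [noiseLaw, measureReal_prod_prod]
  have hcover : (Set.univ : Set G.Noise) ⊆ S ∪ (A ×ˢ Set.univ ∪ Set.univ ×ˢ B) := by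
    intro ω _
    by_contra h
    simp only [Set.mem_union, Set.mem_prod, Set.mem_univ, and_true, true_and, not_or] at h
    obtain ⟨h1, h2, h3⟩ := h
    apply h1
    simp only [hA, Set.mem_ofPred_eq, not_not] at h2
    simp only [hB, Set.mem_ofPred_eq, not_le] at h3
    simp only [hS, Set.mem_ofPred_eq]
    rw [G.hyperedgeObservation_eq]
    refine exactInference_of_isStageOneSolution_iff hn hm hme hy h2 ?_
    simpa only [nodeObservation, mul_assoc, hy.mul_self, mul_one] using h3
  have h := measureReal_mono (μ := G.noiseLaw p q) hcover (measure_ne_top _ _)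
  rw [probReal_univ] at h
  have h4 := measureReal_union_le (μ := G.noiseLaw p q) S (A ×ˢ Set.univ ∪ Set.univ ×ˢ B)
  have h5 := measureReal_union_le (μ := G.noiseLaw p q) (A ×ˢ Set.univ) (Set.univ ×ˢ B)
  rw [hA', hB'] at h5
  unfold successProb
  linarith

lemma UniformHypergraph.successProb_le_one {n m : ℕ} (G : UniformHypergraph n m) {p q : ℝ}
    (hp0 : 0 ≤ p) (hp : p ≤ 1) (hq0 : 0 ≤ q) (hq : q ≤ 1) (y : Fin n → ℝ) :
    G.successProb p q y ≤ 1 := by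
  have := isProbabilityMeasure_flipLaw hp0 hp
  have := isProbabilityMeasure_flipLaw hq0 hq
  have : IsProbabilityMeasure (G.noiseLaw p q) := by unfold noiseLaw; infer_instance
  exact measureReal_le_one

lemma exists_measureReal_stageOne_failure_le {m : ℕ} (hm : m % 4 = 2) {p : ℝ} (hp0 : 0 ≤ p)
    (hp : p < 1 / 2) :
    ∃ C : ℝ, 0 < C ∧ ∃ n₀ : ℕ, ∀ n : ℕ, n₀ ≤ n → ∀ G : UniformHypergraph n m, G.IsComplete →
      ∀ y : Fin n → ℝ, IsSignVector y →
        (Measure.pi fun _ : G.edges => flipLaw p).real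
          {ω | ¬ ∀ Y, IsStageOneSolution (labelTensor m (G.edgeSign ω) y) Y ↔
            Y = tensorPower m y} ≤ C / n := by
  by_cases h2 : m = 2
  · subst h2
    exact exists_measureReal_stageOne_failure_le_two hp0 hp
  · exact exists_measureReal_stageOne_failure_le_of_four_le (by omega)
      (Nat.even_iff.2 (by omega)) hp0 hp

theorem mainTheorem5 (m : ℕ) (hm : m % 4 = 2) (p q : ℝ)
    (hp0 : 0 ≤ p) (hp : p < 1 / 2) (hq0 : 0 ≤ q) (hq : q < 1 / 2) :
    (∃ C : ℝ, 0 < C ∧ ∃ n₀ : ℕ, ∀ n : ℕ, n₀ ≤ n →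
      ∀ G : UniformHypergraph n m, G.IsComplete →
      ∀ yStar : Fin n → ℝ, IsSignVector yStar →
        1 - C / (n : ℝ) ≤ G.successProb p q yStar) ∧
    (∀ (G : ∀ n : ℕ, UniformHypergraph n m) (yStar : ∀ n : ℕ, Fin n → ℝ),
      (∀ n, (G n).IsComplete) → (∀ n, IsSignVector (yStar n)) →
        Tendsto (fun n => (G n).successProb p q (yStar n)) atTop (𝓝 1)) := by
  have hδ : 0 < 1 - 2 * q := by linarith
  have main : ∃ C : ℝ, 0 < C ∧ ∃ n₀ : ℕ, ∀ n : ℕ, n₀ ≤ n →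
      ∀ G : UniformHypergraph n m, G.IsComplete →
      ∀ yStar : Fin n → ℝ, IsSignVector yStar →
        1 - C / (n : ℝ) ≤ G.successProb p q yStar := by
    obtain ⟨C, hC, n₀, h⟩ := exists_measureReal_stageOne_failure_le hm hp0 hp
    refine ⟨C + 1 / ((1 - 2 * q) ^ 2 / 8), by positivity, max n₀ 1, fun n hn G hG y hy => ?_⟩
    have hn1 : 0 < n := (le_max_right _ _).trans hn
    have h1 := h n ((le_max_left _ _).trans hn) G hG y hy
    have h2 := measureReal_nodeObservation_le hq0 hq hn1
    refine le_trans ?_ (G.one_sub_le_successProb hn1 (by omega) (Nat.even_iff.2 (by omega))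
      hp0 hp hq0 hq hy)
    rw [add_div]
    linarith
  refine ⟨main, fun G y hG hy => ?_⟩
  obtain ⟨C, -, n₀, h⟩ := main
  have hlim : Tendsto (fun n : ℕ => 1 - C / (n : ℝ)) atTop (𝓝 1) := by
    simpa using (tendsto_const_div_atTop_nhds_zero_nat C).const_sub 1
  refine tendsto_of_tendsto_of_tendsto_of_le_of_le' hlim tendsto_const_nhds ?_ ?_
  · filter_upwards [eventually_ge_atTop n₀] with n hn using h n hn (G n) (hG n) (y n) (hy n)
  · exact Eventually.of_forall fun n =>
      (G n).successProb_le_one hp0 (by linarith) hq0 (by linarith) (y n)
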